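/- Let $d\ge 2$ be an integer and let $w=(w_i)_{i\ge 0}$ be a non-decreasing sequence of positive real numbers satisfying the strong reinforcement hypothesis $\sum_{i=0}^{\infty} 1/w_i<\infty$. For integers $r,g\ge 0$ put $\pi(r,g)=\frac{w_r}{w_r+w_g}$. Let $X=(R_n,G_n)_{n\ge 0}$, defined on a probability space, be the two-colour urn process with parameter $d$, that is, the Markov chain on $\{0,1,2,\dots\}^2$ with $(R_0,G_0)=(0,0)$ almost surely and with transition probabilities $$\mathbb P\big[(R_{n+1},G_{n+1})=(r+a,\,g+d-a)\,\big|\,(R_n,G_n)=(r,g)\big]=\binom da\,\pi(r,g)^a\,\pi(g,r)^{d-a},\qquad 0\le a\le d .$$ (At each step $d$ balls are drawn with replacement, each of them red with probability $\pi(R_n,G_n)$ and green otherwise, and $d$ new balls of matching colours are added.) Then almost surely the urn eventually draws only one colour: with probability $1$ there exists a time $n$ such that either $(R_{m+1},G_{m+1})=(R_m+d,G_m)$ for all $m\ge n$, or $(R_{m+1},G_{m+1})=(R_m,G_m+d)$ for all $m\ge n$. -/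

import Mathlib

open MeasureTheory

namespace DrawUrn

/-- Probability `w_r / (w_r + w_g)` of drawing a red ball from an urn with `r` red and `g` green
balls. The probability of drawing a green ball is `drawProb w g r`. -/
noncomputable def drawProb (w : ℕ → ℝ) (r g : ℕ) : ℝ := w r / (w r + w g)

/-- Probability that exactly `a` of the `d` balls drawn with replacement from an urn with content
`x = (r, g)` are red (the binomial distribution with parameters `d` and `drawProb w r g`). -/
noncomputable def stepProb (d : ℕ) (w : ℕ → ℝ) (x : ℕ × ℕ) (a : ℕ) : ℝ :=
  (d.choose a : ℝ) * drawProb w x.1 x.2 ^ a * drawProb w x.2 x.1 ^ (d - a)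

/-- `X n = (R n, G n)` is the urn process with parameter `d` and weight sequence `w`: the Markov
chain started at `(0, 0)` which, from the state `x = (r, g)`, jumps to `(r + a, g + (d - a))` with
probability `stepProb d w x a`, for `0 ≤ a ≤ d`. The Markov property and the transition law are
expressed through the probabilities of the finite initial pieces of the path. -/
structure IsUrnProcess {Ω : Type*} [MeasurableSpace Ω] (d : ℕ) (w : ℕ → ℝ)
    (μ : Measure Ω) (X : ℕ → Ω → ℕ × ℕ) : Prop where
  measurable : ∀ n, Measurable (X n)
  start : ∀ᵐ ω ∂μ, X 0 ω = (0, 0)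
  step : ∀ (n : ℕ) (x : ℕ → ℕ × ℕ) (a : ℕ), a ≤ d →
    μ.real {ω | (∀ i ≤ n, X i ω = x i) ∧ X (n + 1) ω = x n + (a, d - a)} =
      μ.real {ω | ∀ i ≤ n, X i ω = x i} * stepProb d w (x n) a

/-- The event that from some time on all balls drawn have the same colour: either at every later
step all `d` balls drawn are red, or at every later step all `d` balls drawn are green. -/
def eventuallyOneColour {Ω : Type*} (d : ℕ) (X : ℕ → Ω → ℕ × ℕ) : Set Ω :=
  {ω | ∃ n, (∀ m, n ≤ m → X (m + 1) ω = X m ω + (d, 0)) ∨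
    (∀ m, n ≤ m → X (m + 1) ω = X m ω + (0, d))}

end DrawUrn

namespace DrawUrn

open Finset Filter Topology

/-! Call it a tie if both colours are drawn for ever; a path without a tie is eventually
monochromatic (`IsUrnPath.eventually_one_colour`). Weight each red ball drawn at `(r, g)` by `1 / w
r` and each green one by `-1 / w g`. The total is a martingale `Z`, and on any path it differs from
a difference of tails of `∑ 1 / w i` by at most `d` times a reciprocal weight (`sum_gain_mem`). A
tie exhausts those tails, so it confines `Z` to a window of width of order `d / w g` about a point
fixed by the present state, `g` being the smaller coordinate.

A state is escaping if a tie from there has probability at most `1 - c`. With `K = d + 256 d²` there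
are two cases. If `w (i + K) < 2 * w i` for arbitrarily large `i`, a tie makes the smaller
coordinate pass just beyond such an `i`. There the tail of `∑ 1 / w i ^ 2` dominates the squared
window, and second and fourth moments of `Z` show that it misses the window with probability bounded
below (`urnExp_window_le`). Otherwise weights eventually double every `K` indices, so `w g` times
the tail of `∑ 1 / w i` from the larger coordinate is at most `2 K`, and the trailing colour may
never be drawn again, with probability bounded below (`isEscaping_of_tail_le`).

Either way a tie visits escaping states infinitely often, with `c` depending only on `d`. By Lévy's
upward theorem the conditional probability of a tie tends to 1 almost surely on that event, a
contradiction unless ties are null. -/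

/-! ### Tails of series -/

/-- The tail `∑_{i ≥ n} f i` of a series. -/
noncomputable def tail (f : ℕ → ℝ) (n : ℕ) : ℝ := ∑' i, f (i + n)

lemma tail_eq_sum_add {f : ℕ → ℝ} (hf : Summable f) (n a : ℕ) :
    tail f n = ∑ i ∈ range a, f (n + i) + tail f (n + a) := by
  have h := ((summable_nat_add_iff n).2 hf).sum_add_tsum_nat_add a
  simp only [tail]
  rw [← h]
  congr 1
  · exact sum_congr rfl fun i _ => by rw [add_comm]
  · exact tsum_congr fun i => by congr 1; ring

lemma tail_nonneg {f : ℕ → ℝ} (h0 : ∀ i, 0 ≤ f i) (n : ℕ) : 0 ≤ tail f n :=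
  tsum_nonneg fun _ => h0 _

lemma tail_antitone {f : ℕ → ℝ} (hf : Summable f) (h0 : ∀ i, 0 ≤ f i) : Antitone (tail f) := by
  intro m n hmn
  obtain ⟨a, rfl⟩ := Nat.exists_eq_add_of_le hmn
  rw [tail_eq_sum_add hf m a]
  linarith [sum_nonneg fun i (_ : i ∈ range a) => h0 (m + i)]

lemma tendsto_tail (f : ℕ → ℝ) : Tendsto (tail f) atTop (𝓝 0) :=
  tendsto_sum_nat_add f

/-- If `f` is halved after every `K` indices, its tail is comparable to its first term. -/
lemma tail_le_of_halving {f : ℕ → ℝ} (hf : Summable f) (hanti : Antitone f) {K n : ℕ}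
    (hK : ∀ i, n ≤ i → f (i + K) ≤ f i / 2) : tail f n ≤ 2 * K * f n := by
  have h1 : tail f (n + K) ≤ tail f n / 2 := by
    unfold tail
    rw [← tsum_div_const]
    refine Summable.tsum_le_tsum (fun i => ?_) ((summable_nat_add_iff _).2 hf)
      (((summable_nat_add_iff _).2 hf).div_const _)
    rw [← add_assoc]
    exact hK _ (by omega)
  have h2 : ∑ i ∈ range K, f (n + i) ≤ K * f n := by
    have := sum_le_card_nsmul (range K) (fun i => f (n + i)) (f n)
      fun i _ => hanti (Nat.le_add_right _ _)
    simpa using this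
  have := tail_eq_sum_add hf n K
  linarith

/-- A sum of consecutive terms of an antitone sequence compared with its first term. -/
lemma mul_sub_tail_sub_tail_mem {f : ℕ → ℝ} (hf : Summable f) (hanti : Antitone f) {a d : ℕ}
    (had : a ≤ d) (n : ℕ) :
    0 ≤ a * f n - (tail f n - tail f (n + a)) ∧
      a * f n - (tail f n - tail f (n + a)) ≤ d * (f n - f (n + a)) := by
  have h := tail_eq_sum_add hf n a
  have h1 : ∑ i ∈ range a, f (n + i) ≤ a * f n := by
    have := sum_le_card_nsmul (range a) (fun i => f (n + i)) (f n)
      fun i _ => hanti (Nat.le_add_right _ _)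
    simpa using this
  have h2 : a * f (n + a) ≤ ∑ i ∈ range a, f (n + i) := by
    have := card_nsmul_le_sum (range a) (fun i => f (n + i)) (f (n + a))
      fun i hi => hanti (by have := mem_range.1 hi; omega)
    simpa using this
  have h3 : f (n + a) ≤ f n := hanti (Nat.le_add_right _ _)
  have h4 : (a : ℝ) ≤ d := by exact_mod_cast had
  constructor
  · linarith
  · nlinarith

/-! ### Expectations along the urn chain -/

/-- The increment, along a step from `x` to `y`, of the martingale attached to the urn. -/
noncomputable def gain (w : ℕ → ℝ) (x y : ℕ × ℕ) : ℝ :=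
  ((y.1 : ℝ) - x.1) / w x.1 - ((y.2 : ℝ) - x.2) / w x.2

/-- Expectation of `Φ (X k) (z + Z k)`, where `X` is the urn chain started at `x` and `Z` is the sum
of the gains along the chain. -/
noncomputable def urnExp (d : ℕ) (w : ℕ → ℝ) :
    ℕ → (ℕ × ℕ → ℝ → ℝ) → ℕ × ℕ → ℝ → ℝ
  | 0, Φ, x, z => Φ x z
  | k + 1, Φ, x, z => ∑ a ∈ range (d + 1), stepProb d w x a *
      urnExp d w k Φ (x + (a, d - a)) (z + gain w x (x + (a, d - a)))

section

variable {d : ℕ} {w : ℕ → ℝ}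

lemma drawProb_nonneg (hpos : ∀ i, 0 < w i) (r g : ℕ) : 0 ≤ drawProb w r g :=
  div_nonneg (hpos _).le (add_pos (hpos _) (hpos _)).le

lemma drawProb_swap (hpos : ∀ i, 0 < w i) (r g : ℕ) : drawProb w g r = 1 - drawProb w r g := by
  have h1 := (add_pos (hpos r) (hpos g)).ne'
  have h2 := (add_pos (hpos g) (hpos r)).ne'
  unfold drawProb
  field_simp
  ring

lemma stepProb_nonneg (hpos : ∀ i, 0 < w i) (x : ℕ × ℕ) (a : ℕ) : 0 ≤ stepProb d w x a :=
  mul_nonneg (mul_nonneg (Nat.cast_nonneg _) (pow_nonneg (drawProb_nonneg hpos _ _) _))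
    (pow_nonneg (drawProb_nonneg hpos _ _) _)

/-- The mean and variance of the binomial draw are then those of the Bernstein polynomials. -/
lemma stepProb_eq_eval (hpos : ∀ i, 0 < w i) (x : ℕ × ℕ) (a : ℕ) :
    stepProb d w x a = (bernsteinPolynomial ℝ d a).eval (drawProb w x.1 x.2) := by
  simp [stepProb, bernsteinPolynomial, drawProb_swap hpos x.1 x.2]

lemma sum_stepProb (hpos : ∀ i, 0 < w i) (x : ℕ × ℕ) :
    ∑ a ∈ range (d + 1), stepProb d w x a = 1 := by
  have h := congrArg (Polynomial.eval (drawProb w x.1 x.2)) (bernsteinPolynomial.sum ℝ d)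
  simpa [Polynomial.eval_finsetSum, stepProb_eq_eval hpos] using h

lemma sum_stepProb_mul_cast (hpos : ∀ i, 0 < w i) (x : ℕ × ℕ) :
    ∑ a ∈ range (d + 1), stepProb d w x a * a = d * drawProb w x.1 x.2 := by
  have h := congrArg (Polynomial.eval (drawProb w x.1 x.2)) (bernsteinPolynomial.sum_smul ℝ d)
  simpa [Polynomial.eval_finsetSum, stepProb_eq_eval hpos, mul_comm] using h

lemma sum_stepProb_variance (hpos : ∀ i, 0 < w i) (x : ℕ × ℕ) :
    ∑ a ∈ range (d + 1), stepProb d w x a * (a - d * drawProb w x.1 x.2) ^ 2 =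
      d * drawProb w x.1 x.2 * (1 - drawProb w x.1 x.2) := by
  have h := congrArg (Polynomial.eval (drawProb w x.1 x.2)) (bernsteinPolynomial.variance ℝ d)
  simp only [Polynomial.eval_finsetSum, Polynomial.eval_mul, Polynomial.eval_pow,
    Polynomial.eval_sub, Polynomial.eval_X, Polynomial.eval_natCast,
    Polynomial.eval_one, nsmul_eq_mul, ← stepProb_eq_eval hpos] at h
  rw [← h]
  exact sum_congr rfl fun a _ => by ring

lemma gain_step (x : ℕ × ℕ) {a : ℕ} (ha : a ≤ d) :
    gain w x (x + (a, d - a)) = a / w x.1 - (d - a) / w x.2 := by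
  simp [gain, Nat.cast_sub ha]

/-- The gain is the centred number of red balls times a factor known before the draw; its first two
moments follow from the binomial ones. -/
lemma gain_step_eq (hpos : ∀ i, 0 < w i) (x : ℕ × ℕ) {a : ℕ} (ha : a ≤ d) :
    gain w x (x + (a, d - a)) = (a - d * drawProb w x.1 x.2) * (1 / w x.1 + 1 / w x.2) := by
  have h1 := (hpos x.1).ne'
  have h2 := (hpos x.2).ne'
  have h3 := (add_pos (hpos x.1) (hpos x.2)).ne'
  rw [gain_step x ha, drawProb]
  field_simp
  ring

lemma sum_stepProb_mul_gain (hpos : ∀ i, 0 < w i) (x : ℕ × ℕ) :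
    ∑ a ∈ range (d + 1), stepProb d w x a * gain w x (x + (a, d - a)) = 0 := by
  have h : ∀ a ∈ range (d + 1), stepProb d w x a * gain w x (x + (a, d - a)) =
      (stepProb d w x a * a - stepProb d w x a * (d * drawProb w x.1 x.2)) *
        (1 / w x.1 + 1 / w x.2) := fun a ha => by
    rw [gain_step_eq hpos x (by have := mem_range.1 ha; omega)]; ring
  rw [sum_congr rfl h, ← sum_mul, sum_sub_distrib, ← sum_mul, sum_stepProb hpos,
    sum_stepProb_mul_cast hpos]
  ring

lemma sum_stepProb_mul_gain_sq (hpos : ∀ i, 0 < w i) (x : ℕ × ℕ) :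
    ∑ a ∈ range (d + 1), stepProb d w x a * gain w x (x + (a, d - a)) ^ 2 =
      d / (w x.1 * w x.2) := by
  have h : ∀ a ∈ range (d + 1), stepProb d w x a * gain w x (x + (a, d - a)) ^ 2 =
      stepProb d w x a * (a - d * drawProb w x.1 x.2) ^ 2 *
        (1 / w x.1 + 1 / w x.2) ^ 2 := fun a ha => by
    rw [gain_step_eq hpos x (by have := mem_range.1 ha; omega)]; ring
  rw [sum_congr rfl h, ← sum_mul, sum_stepProb_variance hpos, ← drawProb_swap hpos]
  have h1 := (hpos x.1).ne'
  have h2 := (hpos x.2).ne'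
  have h3 := (add_pos (hpos x.1) (hpos x.2)).ne'
  have h4 := (add_pos (hpos x.2) (hpos x.1)).ne'
  unfold drawProb
  rw [add_comm (w x.2) (w x.1)]
  field_simp
  ring

lemma sum_stepProb_mul_green (hpos : ∀ i, 0 < w i) (x : ℕ × ℕ) :
    ∑ a ∈ range (d + 1), stepProb d w x a * ((d : ℝ) - a) = d * drawProb w x.2 x.1 := by
  simp only [mul_sub, sum_sub_distrib, ← sum_mul]
  rw [sum_stepProb hpos, sum_stepProb_mul_cast hpos, drawProb_swap hpos x.1 x.2]
  ring

lemma urnExp_mono (hpos : ∀ i, 0 < w i) {Φ Ψ : ℕ × ℕ → ℝ → ℝ} (h : ∀ x z, Φ x z ≤ Ψ x z) (k : ℕ)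
    (x : ℕ × ℕ) (z : ℝ) : urnExp d w k Φ x z ≤ urnExp d w k Ψ x z := by
  induction k generalizing x z with
  | zero => exact h x z
  | succ k ih =>
    exact sum_le_sum fun a _ => mul_le_mul_of_nonneg_left (ih _ _) (stepProb_nonneg hpos _ _)

lemma urnExp_add (Φ Ψ : ℕ × ℕ → ℝ → ℝ) (k : ℕ) (x : ℕ × ℕ) (z : ℝ) :
    urnExp d w k (fun x z => Φ x z + Ψ x z) x z = urnExp d w k Φ x z + urnExp d w k Ψ x z := by
  induction k generalizing x z with
  | zero => rfl
  | succ k ih => simp only [urnExp, ih, mul_add, sum_add_distrib]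

lemma urnExp_const_mul (c : ℝ) (Φ : ℕ × ℕ → ℝ → ℝ) (k : ℕ) (x : ℕ × ℕ) (z : ℝ) :
    urnExp d w k (fun x z => c * Φ x z) x z = c * urnExp d w k Φ x z := by
  induction k generalizing x z with
  | zero => rfl
  | succ k ih =>
    simp only [urnExp, ih, mul_sum]
    exact sum_congr rfl fun a _ => by ring

lemma urnExp_const (hpos : ∀ i, 0 < w i) (c : ℝ) (k : ℕ) (x : ℕ × ℕ) (z : ℝ) :
    urnExp d w k (fun _ _ => c) x z = c := by
  induction k generalizing x z with
  | zero => rfl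
  | succ k ih => simp only [urnExp, ih, ← sum_mul, sum_stepProb hpos, one_mul]

/-- Superharmonic functions have decreasing expectations. -/
lemma urnExp_le_of_superharmonic (hpos : ∀ i, 0 < w i) {Φ : ℕ × ℕ → ℝ → ℝ}
    (h : ∀ x z, urnExp d w 1 Φ x z ≤ Φ x z) (k : ℕ) (x : ℕ × ℕ) (z : ℝ) :
    urnExp d w k Φ x z ≤ Φ x z := by
  induction k generalizing x z with
  | zero => exact le_rfl
  | succ k ih =>
    exact (sum_le_sum fun a _ =>
      mul_le_mul_of_nonneg_left (ih _ _) (stepProb_nonneg hpos _ _)).trans (h x z)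

/-- Subharmonic functions have increasing expectations. -/
lemma le_urnExp_of_subharmonic (hpos : ∀ i, 0 < w i) {Φ : ℕ × ℕ → ℝ → ℝ}
    (h : ∀ x z, Φ x z ≤ urnExp d w 1 Φ x z) (k : ℕ) (x : ℕ × ℕ) (z : ℝ) :
    Φ x z ≤ urnExp d w k Φ x z := by
  induction k generalizing x z with
  | zero => exact le_rfl
  | succ k ih =>
    exact (h x z).trans (sum_le_sum fun a _ =>
      mul_le_mul_of_nonneg_left (ih _ _) (stepProb_nonneg hpos _ _))

lemma urnExp_martingale (hpos : ∀ i, 0 < w i) (k : ℕ) (x : ℕ × ℕ) (z : ℝ) :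
    urnExp d w k (fun _ z => z) x z = z := by
  have h : ∀ x z, urnExp d w 1 (fun _ z => z) x z = z := fun x z => by
    simp only [urnExp, mul_add, sum_add_distrib, ← sum_mul, sum_stepProb hpos,
      sum_stepProb_mul_gain hpos]
    ring
  exact le_antisymm (urnExp_le_of_superharmonic hpos (fun x z => (h x z).le) k x z)
    (le_urnExp_of_subharmonic hpos (fun x z => (h x z).ge) k x z)

lemma swap_step (x : ℕ × ℕ) {a : ℕ} (ha : a ≤ d) :
    (x + (d - a, d - (d - a))).swap = x.swap + (a, d - a) := by
  ext <;> simp [Nat.sub_sub_self ha]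

lemma gain_swap (x y : ℕ × ℕ) : gain w x.swap y.swap = -gain w x y := by
  simp [gain]

lemma stepProb_swap (x : ℕ × ℕ) {a : ℕ} (ha : a ≤ d) :
    stepProb d w x (d - a) = stepProb d w x.swap a := by
  simp only [stepProb, Nat.choose_symm ha, Nat.sub_sub_self ha, Prod.fst_swap, Prod.snd_swap]
  ring

/-- Exchanging the colours negates every gain. This symmetry lets later arguments assume that green
is the trailing colour. -/
lemma urnExp_swap (Φ : ℕ × ℕ → ℝ → ℝ) (k : ℕ) (x : ℕ × ℕ) (z : ℝ) :
    urnExp d w k Φ x.swap z = urnExp d w k (fun x z => Φ x.swap (-z)) x (-z) := by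
  induction k generalizing x z with
  | zero => simp [urnExp]
  | succ k ih =>
    simp only [urnExp]
    rw [← sum_range_reflect (fun a => stepProb d w x a * _)]
    refine sum_congr rfl fun a ha => ?_
    have ha' : a ≤ d := by have := mem_range.1 ha; omega
    have e : d + 1 - 1 - a = d - a := by omega
    rw [e, stepProb_swap x ha', ← swap_step x ha', ih, gain_swap]
    congr 2
    ring

end

/-! ### Moment bounds and anticoncentration for the martingale of gains -/

section

variable {d : ℕ} {w : ℕ → ℝ}

lemma summable_inv_sq (hpos : ∀ i, 0 < w i) (hmono : Monotone w)
    (hsum : Summable (fun i => 1 / w i)) : Summable (fun i => 1 / w i ^ 2) := by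
  refine Summable.of_nonneg_of_le (fun i => by positivity) (fun i => ?_) (hsum.mul_left (1 / w 0))
  rw [div_mul_div_comm, one_mul, sq]
  exact one_div_le_one_div_of_le (mul_pos (hpos _) (hpos _))
    (mul_le_mul_of_nonneg_right (hmono (Nat.zero_le i)) (hpos i).le)

lemma antitone_inv (hpos : ∀ i, 0 < w i) (hmono : Monotone w) : Antitone (fun i => 1 / w i) :=
  fun _ _ h => one_div_le_one_div_of_le (hpos _) (hmono h)

lemma sq_div_le_tail_sub_tail (hpos : ∀ i, 0 < w i) (h2 : Summable (fun i => 1 / w i ^ 2))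
    {a : ℕ} (ha : a ≤ d) (n : ℕ) :
    ((a : ℝ) / w n) ^ 2 ≤
      d ^ 2 * (tail (fun i => 1 / w i ^ 2) n - tail (fun i => 1 / w i ^ 2) (n + a)) := by
  rcases Nat.eq_zero_or_pos a with rfl | h0
  · simp
  have h := tail_eq_sum_add h2 n 1
  have h' := tail_antitone h2 (fun i => by have := hpos i; positivity)
    (show n + 1 ≤ n + a by omega)
  simp only [sum_range_one, add_zero] at h
  calc ((a : ℝ) / w n) ^ 2 = (a : ℝ) ^ 2 * (1 / w n ^ 2) := by ring
    _ ≤ (d : ℝ) ^ 2 * (1 / w n ^ 2) := by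
        have := hpos n
        gcongr
    _ ≤ _ := by
        refine mul_le_mul_of_nonneg_left ?_ (by positivity)
        linarith

/-- A bound for the sum of the squared gains along any path from `x`. -/
noncomputable def sqBudget (d : ℕ) (w : ℕ → ℝ) (x : ℕ × ℕ) : ℝ :=
  d ^ 2 * (tail (fun i => 1 / w i ^ 2) x.1 + tail (fun i => 1 / w i ^ 2) x.2)

lemma tail_inv_sq_nonneg (hpos : ∀ i, 0 < w i) (n : ℕ) : 0 ≤ tail (fun i => 1 / w i ^ 2) n :=
  tail_nonneg (fun i => by have := hpos i; positivity) n

lemma sqBudget_nonneg (hpos : ∀ i, 0 < w i) (x : ℕ × ℕ) : 0 ≤ sqBudget d w x :=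
  mul_nonneg (by positivity)
    (add_nonneg (tail_inv_sq_nonneg hpos _) (tail_inv_sq_nonneg hpos _))

/-- The red and green contributions have opposite signs, so the cross term only helps, and each
square is paid for by the drop of one tail. -/
lemma gain_sq_le (hpos : ∀ i, 0 < w i) (h2 : Summable (fun i => 1 / w i ^ 2)) (x : ℕ × ℕ) {a : ℕ}
    (ha : a ≤ d) :
    gain w x (x + (a, d - a)) ^ 2 ≤ sqBudget d w x - sqBudget d w (x + (a, d - a)) := by
  have hr := sq_div_le_tail_sub_tail hpos h2 ha x.1
  have hg := sq_div_le_tail_sub_tail hpos h2 (Nat.sub_le d a) x.2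
  have h0 : 0 ≤ (a : ℝ) / w x.1 := div_nonneg (Nat.cast_nonneg _) (hpos _).le
  have h1 : 0 ≤ ((d - a : ℕ) : ℝ) / w x.2 := div_nonneg (Nat.cast_nonneg _) (hpos _).le
  have h3 := mul_nonneg h0 h1
  rw [gain_step x ha]
  rw [Nat.cast_sub ha] at *
  simp only [sqBudget, Prod.fst_add, Prod.snd_add]
  linarith [show (a / w x.1 - (d - a) / w x.2) ^ 2 = ((a : ℝ) / w x.1) ^ 2 +
    (((d : ℝ) - a) / w x.2) ^ 2 - 2 * (a / w x.1 * ((d - a) / w x.2)) by ring]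

/-- A pointwise inequality behind the fourth moment bound for martingales whose sum of squared
increments is bounded. -/
lemma quartic_le {z ζ q q' : ℝ} (h0 : 0 ≤ q') (h : ζ ^ 2 ≤ q - q') :
    (z + ζ) ^ 4 + 10 * (z + ζ) ^ 2 * q' + 17 * q' ^ 2 ≤
      z ^ 4 + 10 * z ^ 2 * q + 17 * q ^ 2 + (4 * z ^ 3 + 20 * z * q) * ζ := by
  have h1 : q' ≤ q - ζ ^ 2 := by linarith
  have h2 : 10 * (z + ζ) ^ 2 * q' ≤ 10 * (z + ζ) ^ 2 * (q - ζ ^ 2) :=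
    mul_le_mul_of_nonneg_left h1 (by positivity)
  have h3 : q' ^ 2 ≤ (q - ζ ^ 2) ^ 2 := pow_le_pow_left₀ h0 h1 2
  have h4 : 0 ≤ ζ ^ 2 * (q - ζ ^ 2) := mul_nonneg (sq_nonneg _) (h0.trans h1)
  -- After replacing `q'` by `q - ζ ^ 2`, left minus right is exactly `-(ζ * (2 * z + 4 * ζ)) ^ 2 -
  -- 24 * ζ ^ 2 * (q - ζ ^ 2)`; this is what 10 and 17 achieve.
  nlinarith [sq_nonneg (ζ * (2 * z + 4 * ζ))]

/-- The term linear in the gain averages to zero in `quartic_le`, leaving a supermartingale. From `z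
= 0` it bounds the fourth moment by `17 * sqBudget d w x ^ 2`. -/
lemma urnExp_quartic_le (hpos : ∀ i, 0 < w i) (h2 : Summable (fun i => 1 / w i ^ 2)) (k : ℕ)
    (x : ℕ × ℕ) (z : ℝ) :
    urnExp d w k (fun x z => z ^ 4 + 10 * z ^ 2 * sqBudget d w x + 17 * sqBudget d w x ^ 2) x z ≤
      z ^ 4 + 10 * z ^ 2 * sqBudget d w x + 17 * sqBudget d w x ^ 2 := by
  refine urnExp_le_of_superharmonic hpos
    (Φ := fun x z => z ^ 4 + 10 * z ^ 2 * sqBudget d w x + 17 * sqBudget d w x ^ 2)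
    (fun x z => ?_) k x z
  simp only [urnExp]
  calc _ ≤ ∑ a ∈ range (d + 1), stepProb d w x a *
        (z ^ 4 + 10 * z ^ 2 * sqBudget d w x + 17 * sqBudget d w x ^ 2 +
          (4 * z ^ 3 + 20 * z * sqBudget d w x) * gain w x (x + (a, d - a))) :=
        sum_le_sum fun a ha => mul_le_mul_of_nonneg_left
          (quartic_le (sqBudget_nonneg hpos _)
            (gain_sq_le hpos h2 x (by have := mem_range.1 ha; omega)))
          (stepProb_nonneg hpos _ _)
    _ = (∑ a ∈ range (d + 1), stepProb d w x a) *
          (z ^ 4 + 10 * z ^ 2 * sqBudget d w x + 17 * sqBudget d w x ^ 2) +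
        (∑ a ∈ range (d + 1), stepProb d w x a * gain w x (x + (a, d - a))) *
          (4 * z ^ 3 + 20 * z * sqBudget d w x) := by
        rw [sum_mul, sum_mul, ← sum_add_distrib]
        exact sum_congr rfl fun a _ => by ring
    _ = _ := by rw [sum_stepProb hpos, sum_stepProb_mul_gain hpos]; ring

/-- The conditional variance `d / (w r * w g)` exceeds the mean drop of the green tail, which is at
most `d / ((w r + w g) * w g)`. Truncating at `U` preserves this and gives a bound valid at every
state, as `urnExp_mono` requires. -/
lemma le_urnExp_sq_add_tail (hpos : ∀ i, 0 < w i) (hmono : Monotone w)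
    (h2 : Summable (fun i => 1 / w i ^ 2)) (U : ℝ) (k : ℕ) (x : ℕ × ℕ) (z : ℝ) :
    z ^ 2 + min (tail (fun i => 1 / w i ^ 2) x.2) U ≤
      urnExp d w k (fun x z => z ^ 2 + min (tail (fun i => 1 / w i ^ 2) x.2) U) x z := by
  refine le_urnExp_of_subharmonic hpos
    (Φ := fun x z => z ^ 2 + min (tail (fun i => 1 / w i ^ 2) x.2) U) (fun x z => ?_) k x z
  simp only [urnExp]
  have hw1 := hpos x.1
  have hw2 := hpos x.2
  have hmin : ∀ a ∈ range (d + 1), min (tail (fun i => 1 / w i ^ 2) x.2) U -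
      ((d : ℝ) - a) * (1 / w x.2 ^ 2) ≤
      min (tail (fun i => 1 / w i ^ 2) (x + (a, d - a)).2) U := fun a ha => by
    have ha' : a ≤ d := by have := mem_range.1 ha; omega
    have h := (mul_sub_tail_sub_tail_mem h2 (d := d)
      (fun i j hij => one_div_le_one_div_of_le (pow_pos (hpos i) 2)
        (pow_le_pow_left₀ (hpos i).le (hmono hij) 2)) (Nat.sub_le d a) x.2).1
    rw [Nat.cast_sub ha'] at h
    have h' : (0 : ℝ) ≤ ((d : ℝ) - a) * (1 / w x.2 ^ 2) :=
      mul_nonneg (sub_nonneg.2 (by exact_mod_cast ha')) (by positivity)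
    simp only [Prod.snd_add]
    refine le_min ?_ ?_
    · linarith [min_le_left (tail (fun i => 1 / w i ^ 2) x.2) U]
    · linarith [min_le_right (tail (fun i => 1 / w i ^ 2) x.2) U]
  calc z ^ 2 + min (tail (fun i => 1 / w i ^ 2) x.2) U
      ≤ z ^ 2 + min (tail (fun i => 1 / w i ^ 2) x.2) U +
          (d / (w x.1 * w x.2) - d * drawProb w x.2 x.1 * (1 / w x.2 ^ 2)) := by
        have : d * drawProb w x.2 x.1 * (1 / w x.2 ^ 2) ≤ d / (w x.1 * w x.2) := by
          have e : d * drawProb w x.2 x.1 * (1 / w x.2 ^ 2) =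
              d / ((w x.2 + w x.1) * w x.2) := by
            unfold drawProb
            field_simp
          rw [e]
          gcongr
          linarith
        linarith
    _ = (∑ a ∈ range (d + 1), stepProb d w x a) *
          (z ^ 2 + min (tail (fun i => 1 / w i ^ 2) x.2) U) +
        (∑ a ∈ range (d + 1), stepProb d w x a * gain w x (x + (a, d - a))) * (2 * z) +
        ((∑ a ∈ range (d + 1), stepProb d w x a * gain w x (x + (a, d - a)) ^ 2) -
        (∑ a ∈ range (d + 1), stepProb d w x a * ((d : ℝ) - a)) * (1 / w x.2 ^ 2)) := by
        rw [sum_stepProb hpos, sum_stepProb_mul_gain hpos, sum_stepProb_mul_gain_sq hpos,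
          sum_stepProb_mul_green hpos]
        ring
    _ = ∑ a ∈ range (d + 1), stepProb d w x a * ((z + gain w x (x + (a, d - a))) ^ 2 +
          (min (tail (fun i => 1 / w i ^ 2) x.2) U - ((d : ℝ) - a) * (1 / w x.2 ^ 2))) := by
        rw [sum_mul, sum_mul, sum_mul, ← sum_sub_distrib, ← sum_add_distrib, ← sum_add_distrib]
        exact sum_congr rfl fun a _ => by ring
    _ ≤ _ := sum_le_sum fun a ha => mul_le_mul_of_nonneg_left
        (by linarith [hmin a ha]) (stepProb_nonneg hpos _ _)

lemma sq_sub_le_quartic {α : ℝ} (hα : 0 < α) (z t : ℝ) :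
    (z - t) ^ 2 ≤ 8 * α * (z ^ 4 + t ^ 4) + 1 / (4 * α) := by
  have h8 : ((z - t) ^ 2) ^ 2 ≤ 8 * (z ^ 4 + t ^ 4) := by
    have h1 : (z - t) ^ 2 ≤ 2 * (z ^ 2 + t ^ 2) := by nlinarith [sq_nonneg (z + t)]
    have h2 := pow_le_pow_left₀ (sq_nonneg _) h1 2
    nlinarith [sq_nonneg (z ^ 2 - t ^ 2)]
  have h8' := mul_le_mul_of_nonneg_left h8 hα.le
  have e : α * ((z - t) ^ 2) ^ 2 + 1 / (4 * α) - (z - t) ^ 2 =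
      α * ((z - t) ^ 2 - 1 / (2 * α)) ^ 2 := by
    field_simp
    ring
  have : 0 ≤ α * ((z - t) ^ 2 - 1 / (2 * α)) ^ 2 := by positivity
  linarith

/-- Here `p` is the probability of the window. The constant `8704 = 16 * 8 * 68` makes the fourth
moment terms at most `(U + t ^ 2) / 16`, and `17408 = 8 * 2176` makes `1 / (4 * α) * (1 - p)` at
most `(U + t ^ 2) / 8` if the claim fails. -/
lemma prob_le_of_moment_bound {U t p D α : ℝ} (hU : 0 < U) (hD : 1 ≤ D)
    (hα : α = 1 / (8704 * D * (U + t ^ 2)))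
    (h : U ≤ 17 / 16 * U + 8 * α * t ^ 4 + 1 / (4 * α) - t ^ 2 + 8 * α * (68 * D * U ^ 2) -
      (1 / (4 * α) + U / 2) * p) : p ≤ 1 - 1 / (17408 * D) := by
  have hs : 0 < U + t ^ 2 := by positivity
  have hD0 : 0 < D := by linarith
  have hα0 : 0 < α := by rw [hα]; positivity
  have hinv : 1 / (4 * α) = 2176 * D * (U + t ^ 2) := by
    rw [hα]
    field_simp
    norm_num
  have hsum : 8 * α * (68 * D * U ^ 2) + 8 * α * t ^ 4 ≤ (U + t ^ 2) / 16 := by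
    have h1 : 68 * D * U ^ 2 + t ^ 4 ≤ 68 * D * (U + t ^ 2) ^ 2 := by
      have h3 : 0 ≤ t ^ 4 := by positivity
      have h5 : t ^ 4 ≤ D * t ^ 4 := le_mul_of_one_le_left h3 hD
      have h6 : 0 ≤ D * (U * t ^ 2) := by positivity
      nlinarith
    calc _ = 8 * α * (68 * D * U ^ 2 + t ^ 4) := by ring
      _ ≤ 8 * α * (68 * D * (U + t ^ 2) ^ 2) := mul_le_mul_of_nonneg_left h1 (by positivity)
      _ = _ := by
          rw [hα]
          field_simp
          norm_num
  by_contra hcon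
  have hp1 : 1 - p < 1 / (17408 * D) := by linarith [not_le.1 hcon]
  have hp2 : 1 / (4 * α) * (1 - p) ≤ (U + t ^ 2) / 8 := by
    calc 1 / (4 * α) * (1 - p) ≤ 1 / (4 * α) * (1 / (17408 * D)) :=
          mul_le_mul_of_nonneg_left hp1.le (by positivity)
      _ = _ := by
          rw [hinv]
          field_simp
          norm_num
  have hp3 : 1 / (17408 * D) ≤ 1 / 17408 :=
    one_div_le_one_div_of_le (by norm_num) (by linarith)
  have hUp : U / 2 * (1 / 2) < U / 2 * p := mul_lt_mul_of_pos_left (by linarith) (by linarith)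
  linarith [sq_nonneg t]

/-- Anticoncentration: the martingale of gains is not concentrated on an interval that is short
compared with its standard deviation. -/
lemma urnExp_window_le (hd : 1 ≤ d) (hpos : ∀ i, 0 < w i) (hmono : Monotone w)
    (h2 : Summable (fun i => 1 / w i ^ 2)) {x : ℕ × ℕ} (hx : x.2 ≤ x.1)
    (hU : 64 * d ^ 2 / w x.2 ^ 2 ≤ tail (fun i => 1 / w i ^ 2) x.2) {N : ℕ}
    (hN : tail (fun i => 1 / w i ^ 2) N ≤ tail (fun i => 1 / w i ^ 2) x.2 / 2) (t : ℝ) (k : ℕ) :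
    urnExp d w k (fun y z => Set.indicator
      {p : (ℕ × ℕ) × ℝ | N ≤ p.1.2 ∧ |p.2 - t| ≤ 2 * d / w x.2} 1 (y, z)) x 0 ≤
      1 - 1 / (17408 * d ^ 4) := by
  set B := {p : (ℕ × ℕ) × ℝ | N ≤ p.1.2 ∧ |p.2 - t| ≤ 2 * d / w x.2}
  generalize hUdef : tail (fun i => 1 / w i ^ 2) x.2 = U at hU hN
  have hd1 : (1 : ℝ) ≤ d := by exact_mod_cast hd
  have hd4 : (1 : ℝ) ≤ d ^ 4 := one_le_pow₀ hd1
  have hw := hpos x.2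
  have hUpos : 0 < U := lt_of_lt_of_le (by positivity) hU
  obtain ⟨α, hα⟩ : ∃ α : ℝ, α = 1 / (8704 * d ^ 4 * (U + t ^ 2)) := ⟨_, rfl⟩
  have hα0 : 0 < α := by rw [hα]; positivity
  -- Off `B`, the square is bounded by a quartic and the tail by `U`. On `B`, `(z - t) ^ 2 ≤ U / 16`
  -- and the tail is at most `U / 2`, so the quantity `1 / (4 * α) + U / 2` is saved.
  have hpt : ∀ (y : ℕ × ℕ) (z : ℝ),
      z ^ 2 + min (tail (fun i => 1 / w i ^ 2) y.2) U ≤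
        ((17 / 16 * U + 8 * α * t ^ 4 + 1 / (4 * α) - t ^ 2) +
          (2 * t) * z) + ((8 * α) *
            (z ^ 4 + 10 * z ^ 2 * sqBudget d w y + 17 * sqBudget d w y ^ 2) +
          (-(1 / (4 * α) + U / 2)) * Set.indicator B 1 (y, z)) := by
    intro y z
    have hq := sqBudget_nonneg (d := d) hpos y
    have hq' : 0 ≤ 8 * α * (10 * z ^ 2 * sqBudget d w y + 17 * sqBudget d w y ^ 2) := by
      positivity
    have hsq : (z - t) ^ 2 = z ^ 2 - 2 * t * z + t ^ 2 := by ring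
    by_cases hyz : (y, z) ∈ B
    · rw [Set.indicator_of_mem hyz, Pi.one_apply]
      have h1 : (z - t) ^ 2 ≤ U / 16 := by
        have : (z - t) ^ 2 ≤ (2 * d / w x.2) ^ 2 := sq_le_sq' (by linarith [(abs_le.1 hyz.2).1])
          (abs_le.1 hyz.2).2
        have e : (2 * d / w x.2) ^ 2 = (64 * d ^ 2 / w x.2 ^ 2) / 16 := by ring
        linarith
      have h3 : min (tail (fun i => 1 / w i ^ 2) y.2) U ≤ U / 2 :=
        (min_le_left _ _).trans ((tail_antitone h2
          (fun i => by have := hpos i; positivity) hyz.1).trans hN)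
      have h4 : 0 ≤ 8 * α * (z ^ 4 + t ^ 4) := by positivity
      linarith
    · rw [Set.indicator_of_notMem hyz]
      have h3 := min_le_right (tail (fun i => 1 / w i ^ 2) y.2) U
      have h4 := sq_sub_le_quartic hα0 z t
      linarith
  have hE := (le_urnExp_sq_add_tail (d := d) hpos hmono h2 U k x 0).trans
    (urnExp_mono hpos hpt k x 0)
  rw [urnExp_add, urnExp_add, urnExp_add, urnExp_const hpos, urnExp_const_mul, urnExp_const_mul,
    urnExp_const_mul, urnExp_martingale hpos, hUdef, min_self] at hE
  have hquart := urnExp_quartic_le (d := d) hpos h2 k x 0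
  have hbud : sqBudget d w x ≤ 2 * d ^ 2 * U := by
    have h := tail_antitone h2 (fun i => by have := hpos i; positivity) hx
    have : sqBudget d w x ≤ d ^ 2 * (U + U) :=
      mul_le_mul_of_nonneg_left (by linarith) (by positivity)
    linarith
  have hbud2 : sqBudget d w x ^ 2 ≤ 4 * d ^ 4 * U ^ 2 :=
    (pow_le_pow_left₀ (sqBudget_nonneg hpos x) hbud 2).trans_eq (by ring)
  have hquart2 := mul_le_mul_of_nonneg_left
    (hquart.trans (show _ ≤ 68 * (d : ℝ) ^ 4 * U ^ 2 by linarith))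
    (show 0 ≤ 8 * α by positivity)
  exact prob_le_of_moment_bound hUpos hd4 hα (by linarith)

end

/-! ### Escaping states and the dichotomy on the growth of the weights -/

/-- Paths that the urn process may follow. -/
def IsUrnPath (d : ℕ) (y : ℕ → ℕ × ℕ) : Prop := ∀ n, ∃ a ≤ d, y (n + 1) = y n + (a, d - a)

/-- A state `x` is `c`-escaping if some sequence of events, each of probability at least `c` for the
urn started at `x`, eventually excludes every path along which both colours are drawn for ever. -/
def IsEscaping (d : ℕ) (w : ℕ → ℝ) (c : ℝ) (x : ℕ × ℕ) : Prop :=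
  ∃ B : Set ((ℕ × ℕ) × ℝ),
    (∀ k, urnExp d w k (fun y z => B.indicator 1 (y, z)) x 0 ≤ 1 - c) ∧
    ∀ y : ℕ → ℕ × ℕ, y 0 = x → IsUrnPath d y → (∀ N, ∃ n, N ≤ (y n).1 ∧ N ≤ (y n).2) →
      ∀ᶠ k in atTop, (y k, ∑ j ∈ range k, gain w (y j) (y (j + 1))) ∈ B

section

variable {d : ℕ} {w : ℕ → ℝ}

lemma IsUrnPath.monotone {y : ℕ → ℕ × ℕ} (hy : IsUrnPath d y) : Monotone y :=
  monotone_nat_of_le_succ fun n => by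
    obtain ⟨a, -, h⟩ := hy n
    rw [h]
    exact ⟨Nat.le_add_right _ _, Nat.le_add_right _ _⟩

lemma IsUrnPath.shift {y : ℕ → ℕ × ℕ} (hy : IsUrnPath d y) (n : ℕ) :
    IsUrnPath d (fun k => y (n + k)) := fun k => hy (n + k)

lemma IsUrnPath.swap {y : ℕ → ℕ × ℕ} (hy : IsUrnPath d y) : IsUrnPath d (fun k => (y k).swap) :=
  fun n => by
    obtain ⟨a, ha, h⟩ := hy n
    refine ⟨d - a, Nat.sub_le _ _, ?_⟩
    simp only [h]
    ext <;> simp [Nat.sub_sub_self ha]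

lemma IsUrnPath.eventually_ge {y : ℕ → ℕ × ℕ} (hy : IsUrnPath d y)
    (h : ∀ N, ∃ n, N ≤ (y n).1 ∧ N ≤ (y n).2) (N : ℕ) :
    ∀ᶠ k in atTop, N ≤ (y k).1 ∧ N ≤ (y k).2 := by
  obtain ⟨n, h1, h2⟩ := h N
  filter_upwards [eventually_ge_atTop n] with k hk
  exact ⟨h1.trans (hy.monotone hk).1, h2.trans (hy.monotone hk).2⟩

lemma IsEscaping.mono {c c' : ℝ} {x : ℕ × ℕ} (h : IsEscaping d w c x) (hc : c' ≤ c) :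
    IsEscaping d w c' x := by
  obtain ⟨B, h1, h2⟩ := h
  exact ⟨B, fun k => (h1 k).trans (by linarith), h2⟩

lemma IsEscaping.swap {c : ℝ} {x : ℕ × ℕ} (h : IsEscaping d w c x) :
    IsEscaping d w c x.swap := by
  obtain ⟨B, h1, h2⟩ := h
  refine ⟨{p | (p.1.swap, -p.2) ∈ B}, fun k => ?_, fun y h0 hy hinf => ?_⟩
  · rw [urnExp_swap, neg_zero]
    refine (congrArg (fun Φ => urnExp d w k Φ x 0) ?_).trans_le (h1 k)
    funext y z
    by_cases hyz : (y, z) ∈ B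
    · rw [Set.indicator_of_mem hyz, Set.indicator_of_mem (by simpa using hyz)]; rfl
    · rw [Set.indicator_of_notMem hyz, Set.indicator_of_notMem (by simpa using hyz)]
  · filter_upwards [h2 (fun k => (y k).swap) (by simp [h0]) hy.swap
      fun N => (hinf N).imp fun n hn => hn.symm] with k hk
    simpa [gain_swap] using hk

/-- Along a path of the urn, the martingale of gains stays close to an explicit function of the
state. -/
lemma sum_gain_mem (hpos : ∀ i, 0 < w i) (hmono : Monotone w)
    (hsum : Summable (fun i => 1 / w i)) {y : ℕ → ℕ × ℕ} (hy : IsUrnPath d y) (k : ℕ) :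
    -(d * (1 / w (y 0).2 - 1 / w (y k).2)) ≤
        ∑ j ∈ range k, gain w (y j) (y (j + 1)) -
          ((tail (fun i => 1 / w i) (y 0).1 - tail (fun i => 1 / w i) (y k).1) -
            (tail (fun i => 1 / w i) (y 0).2 - tail (fun i => 1 / w i) (y k).2)) ∧
      ∑ j ∈ range k, gain w (y j) (y (j + 1)) -
          ((tail (fun i => 1 / w i) (y 0).1 - tail (fun i => 1 / w i) (y k).1) -
            (tail (fun i => 1 / w i) (y 0).2 - tail (fun i => 1 / w i) (y k).2)) ≤
        d * (1 / w (y 0).1 - 1 / w (y k).1) := by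
  induction k with
  | zero => simp
  | succ k ih =>
    obtain ⟨a, ha, h⟩ := hy k
    have hr := mul_sub_tail_sub_tail_mem hsum (antitone_inv hpos hmono) ha (y k).1
    have hg := mul_sub_tail_sub_tail_mem hsum (antitone_inv hpos hmono) (Nat.sub_le d a) (y k).2
    rw [Nat.cast_sub ha] at hg
    have e : gain w (y k) (y (k + 1)) =
        a * (1 / w (y k).1) - ((d : ℝ) - a) * (1 / w (y k).2) := by
      rw [h, gain_step _ ha]; ring
    have e1 : (y (k + 1)).1 = (y k).1 + a := by rw [h]; rfl
    have e2 : (y (k + 1)).2 = (y k).2 + (d - a) := by rw [h]; rfl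
    rw [sum_range_succ, e, e1, e2]
    constructor <;> linarith [ih.1, ih.2, hr.1, hr.2, hg.1, hg.2]

/-- States whose smaller coordinate has a large tail of inverse squared weights are escaping,
because the final value of the martingale fluctuates too much for a tie. -/
lemma isEscaping_of_le_tail (hd : 1 ≤ d) (hpos : ∀ i, 0 < w i) (hmono : Monotone w)
    (hsum : Summable (fun i => 1 / w i)) {x : ℕ × ℕ} (hx : x.2 ≤ x.1)
    (hU : 64 * d ^ 2 / w x.2 ^ 2 ≤ tail (fun i => 1 / w i ^ 2) x.2) :
    IsEscaping d w (1 / (17408 * d ^ 4)) x := by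
  have h2 := summable_inv_sq hpos hmono hsum
  have hd0 : (0 : ℝ) < d := by exact_mod_cast hd
  have hwx := hpos x.2
  have hUpos : 0 < tail (fun i => 1 / w i ^ 2) x.2 := lt_of_lt_of_le (by positivity) hU
  have hpos2 : 0 < (d : ℝ) / w x.2 := by positivity
  -- Beyond `N` the unspent tails of `1 / w` cost at most `d / w x.2`; with the error in
  -- `sum_gain_mem` this gives the half-width `2 * d / w x.2`.
  obtain ⟨N, hN1, hN2⟩ := (((tendsto_tail (fun i => 1 / w i ^ 2)).eventually_le_const
    (half_pos hUpos)).and ((tendsto_tail (fun i => 1 / w i)).eventually_le_const hpos2)).exists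
  refine ⟨_, urnExp_window_le hd hpos hmono h2 hx hU hN1
    (tail (fun i => 1 / w i) x.1 - tail (fun i => 1 / w i) x.2), fun y h0 hy hinf => ?_⟩
  filter_upwards [hy.eventually_ge hinf N] with k hk
  refine ⟨hk.2, ?_⟩
  have h := sum_gain_mem hpos hmono hsum hy k
  rw [h0] at h
  have hnn : ∀ i, 0 ≤ 1 / w i := fun i => by have := hpos i; positivity
  have a1 := tail_antitone hsum hnn hk.1
  have a2 := tail_antitone hsum hnn hk.2
  have b1 := tail_nonneg hnn (y k).1
  have b2 := tail_nonneg hnn (y k).2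
  have c1 := mul_nonneg hd0.le (hnn (y k).1)
  have c2 := mul_nonneg hd0.le (hnn (y k).2)
  have c3 : (d : ℝ) * (1 / w x.1) ≤ d * (1 / w x.2) :=
    mul_le_mul_of_nonneg_left (antitone_inv hpos hmono hx) hd0.le
  have e : (d : ℝ) / w x.2 = d * (1 / w x.2) := by ring
  have e' : 2 * (d : ℝ) / w x.2 = 2 * (d * (1 / w x.2)) := by ring
  rw [e] at hN2
  rw [e', abs_le]
  constructor <;> linarith [h.1, h.2]

/-- States with a small tail of inverse weights are escaping, because the urn may draw only one
colour from there on. -/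
lemma isEscaping_of_tail_le (hpos : ∀ i, 0 < w i)
    (hsum : Summable (fun i => 1 / w i)) {x : ℕ × ℕ} {C : ℝ}
    (hC : w x.2 * tail (fun i => 1 / w i) x.1 ≤ C) :
    IsEscaping d w (Real.exp (-(d * C))) x := by
  set g := x.2 with hg
  refine ⟨{p | p.1.2 ≠ g}, fun k => ?_, fun y _ hy hinf => ?_⟩
  -- A subharmonic lower bound for the probability that green stays at `g`: an all-red draw at `r`
  -- has probability at least `exp (-(d * w g / w r))`, because `1 + u ≤ exp u`.
  · set Φ : ℕ × ℕ → ℝ → ℝ := fun y _ =>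
      if y.2 = g then Real.exp (-(d * (w g * tail (fun i => 1 / w i) y.1))) else 0 with hΦ
    have hΦ0 : ∀ y z, 0 ≤ Φ y z := fun y z => by
      simp only [hΦ]
      split_ifs
      exacts [(Real.exp_pos _).le, le_rfl]
    have hsub : ∀ y z, Φ y z ≤ urnExp d w 1 Φ y z := by
      intro y z
      by_cases hy : y.2 = g
      · refine le_trans ?_ (single_le_sum (f := fun a => stepProb d w y a *
          Φ (y + (a, d - a)) (z + gain w y (y + (a, d - a))))
          (fun a _ => mul_nonneg (stepProb_nonneg hpos _ _)
            (hΦ0 (y + (a, d - a)) (z + gain w y (y + (a, d - a))))) (self_mem_range_succ d))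
        have hd' : (y + (d, d - d)).2 = g := by simp [hy]
        have hr := hpos y.1
        have hgw := hpos g
        have hexp : Real.exp (-(w g / w y.1)) ≤ drawProb w y.1 y.2 := by
          rw [hy, Real.exp_neg, drawProb, inv_le_comm₀ (Real.exp_pos _) (by positivity), inv_div]
          have e : (w y.1 + w g) / w y.1 = w g / w y.1 + 1 := by
            field_simp
            exact add_comm _ _
          rw [e]
          exact Real.add_one_le_exp _
        have hpow : Real.exp (-(d * (w g / w y.1))) ≤ stepProb d w y d := by
          have := pow_le_pow_left₀ (Real.exp_pos _).le hexp d
          rw [← Real.exp_nat_mul] at this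
          simpa [stepProb] using this
        simp only [hΦ, if_pos hy, if_pos hd']
        refine le_trans ?_ (mul_le_mul_of_nonneg_right hpow (Real.exp_pos _).le)
        rw [← Real.exp_add, Real.exp_le_exp]
        rcases Nat.eq_zero_or_pos d with rfl | hd
        · simp
        have h := tail_eq_sum_add hsum y.1 1
        have h' := tail_antitone hsum (fun i => by have := hpos i; positivity)
          (show y.1 + 1 ≤ (y + (d, d - d)).1 by simp; omega)
        simp only [sum_range_one, add_zero] at h
        have h3 : w g / w y.1 + w g * tail (fun i => 1 / w i) (y + (d, d - d)).1 ≤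
            w g * tail (fun i => 1 / w i) y.1 := by
          rw [h, mul_add, mul_one_div]
          have := mul_le_mul_of_nonneg_left h' hgw.le
          linarith
        have := mul_le_mul_of_nonneg_left h3 (Nat.cast_nonneg (α := ℝ) d)
        linarith
      · simp only [hΦ, if_neg hy]
        exact sum_nonneg fun a _ => mul_nonneg (stepProb_nonneg hpos _ _)
          (hΦ0 (y + (a, d - a)) (z + gain w y (y + (a, d - a))))
    have h1 := le_urnExp_of_subharmonic hpos hsub k x 0
    have h2 : Real.exp (-(d * C)) ≤ Φ x 0 := by
      simp only [hΦ, if_pos hg.symm, Real.exp_le_exp]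
      have := mul_le_mul_of_nonneg_left hC (Nat.cast_nonneg (α := ℝ) d)
      linarith
    have h3 : urnExp d w k (fun y z =>
        Set.indicator {p : (ℕ × ℕ) × ℝ | p.1.2 ≠ g} 1 (y, z) + Φ y z) x 0 ≤ 1 := by
      rw [← urnExp_const (d := d) hpos 1 k x 0]
      refine urnExp_mono hpos (fun y z => ?_) k x 0
      by_cases hy : y.2 = g
      · rw [Set.indicator_of_notMem (by simpa using hy)]
        simp only [hΦ, if_pos hy, zero_add]
        refine Real.exp_le_one_iff.2 (neg_nonpos.2 ?_)
        have := tail_nonneg (fun i => (one_div_pos.2 (hpos i)).le) y.1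
        have := hpos g
        positivity
      · rw [Set.indicator_of_mem (by simpa using hy)]
        simp [hΦ, if_neg hy]
    rw [urnExp_add] at h3
    linarith
  · filter_upwards [hy.eventually_ge hinf (g + 1)] with k hk
    exact (Nat.lt_of_succ_le hk.2).ne'

/-- If the weights have not doubled `K = d + 256 d²` indices after `i`, states whose smaller
coordinate lies in `[i, i + d)` are escaping. -/
lemma isEscaping_of_lt_two_mul (hd : 1 ≤ d) (hpos : ∀ i, 0 < w i) (hmono : Monotone w)
    (hsum : Summable (fun i => 1 / w i)) {i : ℕ} (hi : w (i + (d + 256 * d ^ 2)) < 2 * w i)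
    {x : ℕ × ℕ} (hx : x.2 ≤ x.1) (h1 : i ≤ x.2) (h2 : x.2 < i + d) :
    IsEscaping d w (1 / (17408 * d ^ 4)) x := by
  refine isEscaping_of_le_tail hd hpos hmono hsum hx ?_
  have hs := summable_inv_sq hpos hmono hsum
  have hw := hpos x.2
  rw [tail_eq_sum_add hs x.2 (256 * d ^ 2)]
  have h3 := tail_inv_sq_nonneg hpos (x.2 + 256 * d ^ 2)
  -- There are `256 * d ^ 2` terms of at least `1 / (4 * w x.2 ^ 2)`; the extra `d` in `K` absorbs
  -- the offset of `x.2` from `i`.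
  have h4 := card_nsmul_le_sum (range (256 * d ^ 2)) (fun j => 1 / w (x.2 + j) ^ 2)
    (1 / (4 * w x.2 ^ 2)) fun j hj => by
      have hj' := mem_range.1 hj
      have hle : w (x.2 + j) ≤ 2 * w x.2 := by
        have := hmono (show x.2 + j ≤ i + (d + 256 * d ^ 2) by omega)
        have := hmono h1
        linarith
      have := hpos (x.2 + j)
      refine one_div_le_one_div_of_le (by positivity) ?_
      calc w (x.2 + j) ^ 2 ≤ (2 * w x.2) ^ 2 := pow_le_pow_left₀ this.le hle 2
        _ = _ := by ring
  simp only [card_range, nsmul_eq_mul, Nat.cast_mul, Nat.cast_pow, Nat.cast_ofNat] at h4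
  have e : (256 * (d : ℝ) ^ 2) * (1 / (4 * w x.2 ^ 2)) = 64 * d ^ 2 / w x.2 ^ 2 := by
    field_simp
    norm_num
  linarith

/-- If the weights double every `K` indices beyond the smaller coordinate, the state is escaping. -/
lemma isEscaping_of_two_mul_le (hpos : ∀ i, 0 < w i) (hmono : Monotone w)
    (hsum : Summable (fun i => 1 / w i)) {K N : ℕ} (hK : ∀ i, N ≤ i → 2 * w i ≤ w (i + K))
    {x : ℕ × ℕ} (hx : x.2 ≤ x.1) (hN : N ≤ x.1) :
    IsEscaping d w (Real.exp (-(d * (2 * K)))) x := by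
  refine isEscaping_of_tail_le hpos hsum ?_
  have h := tail_le_of_halving hsum (antitone_inv hpos hmono) (K := K) (n := x.1) fun i hi => by
    have := hpos i
    rw [div_div, mul_comm]
    exact one_div_le_one_div_of_le (by positivity) (hK i (hN.trans hi))
  have h1 := hpos x.1
  have h2 := hpos x.2
  calc w x.2 * tail (fun i => 1 / w i) x.1 ≤ w x.1 * (2 * K * (1 / w x.1)) :=
        mul_le_mul (hmono hx) h (tail_nonneg (fun i => (one_div_pos.2 (hpos i)).le) _) h1.le
    _ = 2 * K := by field_simp

/-- A path along which both coordinates tend to infinity visits `c`-escaping states infinitely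
often, for a constant `c`. -/
lemma exists_frequently_isEscaping (hd : 1 ≤ d) (hpos : ∀ i, 0 < w i) (hmono : Monotone w)
    (hsum : Summable (fun i => 1 / w i)) :
    ∃ c > 0, ∀ y : ℕ → ℕ × ℕ, IsUrnPath d y → y 0 = 0 →
      (∀ N, ∃ n, N ≤ (y n).1 ∧ N ≤ (y n).2) → ∃ᶠ n in atTop, IsEscaping d w c (y n) := by
  have hd0 : (0 : ℝ) < d := by exact_mod_cast hd
  by_cases hflat : ∃ N, ∀ i, N ≤ i → 2 * w i ≤ w (i + (d + 256 * d ^ 2))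
  · obtain ⟨N, hN⟩ := hflat
    refine ⟨_, Real.exp_pos (-(d * (2 * (d + 256 * d ^ 2 : ℕ)))), fun y hy _ hinf => ?_⟩
    refine Eventually.frequently ?_
    filter_upwards [hy.eventually_ge hinf N] with n hn
    rcases le_total (y n).2 (y n).1 with h | h
    · exact isEscaping_of_two_mul_le hpos hmono hsum hN h hn.1
    · exact (isEscaping_of_two_mul_le (x := (y n).swap) hpos hmono hsum hN h hn.2).swap
  · push Not at hflat
    refine ⟨1 / (17408 * d ^ 4), by positivity, fun y hy h0 hinf => ?_⟩
    rw [frequently_atTop]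
    intro m
    obtain ⟨i, hi, hlt⟩ := hflat ((y m).1 + (y m).2 + 1)
    -- At the first time both coordinates reach `i`, one of them was below `i` a step earlier, so
    -- the smaller one lies in `[i, i + d)`. As `i` exceeds both coordinates at time `m`, this time
    -- is not before `m`.
    have hex : ∃ n, i ≤ (y n).1 ∧ i ≤ (y n).2 := hinf i
    classical
    have hspec := Nat.find_spec hex
    have hmin := fun n => Nat.find_min hex (m := n)
    set n := Nat.find hex with hn
    have hmn : m ≤ n := by
      by_contra hlt'
      have := (hy.monotone (le_of_not_ge hlt')).1
      have h1 := hspec.1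
      omega
    refine ⟨n, hmn, ?_⟩
    have hnpos : n ≠ 0 := by
      intro h
      rw [h, h0] at hspec
      have := hspec.1
      simp at this
      omega
    obtain ⟨n', hn'⟩ := Nat.exists_eq_succ_of_ne_zero hnpos
    have hprev := hmin n' (by omega)
    obtain ⟨a, ha, hstep⟩ := hy n'
    rw [hn', Nat.succ_eq_add_one] at hspec ⊢
    have e1 : (y (n' + 1)).1 = (y n').1 + a := by rw [hstep]; rfl
    have e2 : (y (n' + 1)).2 = (y n').2 + (d - a) := by rw [hstep]; rfl
    rcases le_total (y (n' + 1)).2 (y (n' + 1)).1 with h | h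
    · exact isEscaping_of_lt_two_mul hd hpos hmono hsum hlt h hspec.2 (by omega)
    · exact (isEscaping_of_lt_two_mul (x := (y (n' + 1)).swap) hd hpos hmono hsum hlt h hspec.1
        (by simp only [Prod.snd_swap]; omega)).swap

end

/-- A path with a bounded coordinate is eventually driven by one colour. -/
lemma IsUrnPath.eventually_one_colour {d : ℕ} {y : ℕ → ℕ × ℕ} (hy : IsUrnPath d y)
    (h : ¬ ∀ N, ∃ n, N ≤ (y n).1 ∧ N ≤ (y n).2) :
    ∃ n, (∀ m, n ≤ m → y (m + 1) = y m + (d, 0)) ∨ (∀ m, n ≤ m → y (m + 1) = y m + (0, d)) := by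
  have hstab : ∀ f : ℕ → ℕ, Monotone f → (∃ N, ∀ n, f n < N) → ∃ n, ∀ m, n ≤ m → f m = f n := by
    intro f hf hbdd
    obtain ⟨N, hN⟩ := hbdd
    obtain ⟨n, hn⟩ := WellFoundedGT.monotone_chain_condition
      (⟨fun n => ⟨f n, hN n⟩, fun a b hab => hf hab⟩ : ℕ →o Fin N)
    exact ⟨n, fun m hm => (congrArg Fin.val (hn m hm)).symm⟩
  push Not at h
  obtain ⟨N, hN⟩ := h
  have hbdd : (∃ N, ∀ n, (y n).1 < N) ∨ (∃ N, ∀ n, (y n).2 < N) := by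
    by_contra! hcon
    obtain ⟨n1, h1⟩ := hcon.1 N
    obtain ⟨n2, h2⟩ := hcon.2 N
    have e1 := (hy.monotone (le_max_left n1 n2)).1
    have e2 := (hy.monotone (le_max_right n1 n2)).2
    have := hN (max n1 n2) (h1.trans e1)
    omega
  rcases hbdd with hb | hb
  · obtain ⟨n, hn⟩ := hstab _ (fun a b hab => (hy.monotone hab).1) hb
    refine ⟨n, Or.inr fun m hm => ?_⟩
    obtain ⟨a, ha, h⟩ := hy m
    have e : (y (m + 1)).1 = (y m).1 + a := by rw [h]; rfl
    have ha0 : a = 0 := by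
      have := hn m hm
      have := hn (m + 1) (by omega)
      omega
    rw [h, ha0, Nat.sub_zero]
  · obtain ⟨n, hn⟩ := hstab _ (fun a b hab => (hy.monotone hab).2) hb
    refine ⟨n, Or.inl fun m hm => ?_⟩
    obtain ⟨a, ha, h⟩ := hy m
    have e : (y (m + 1)).2 = (y m).2 + (d - a) := by rw [h]; rfl
    have ha0 : a = d := by
      have := hn m hm
      have := hn (m + 1) (by omega)
      omega
    rw [h, ha0, Nat.sub_self]

/-! ### From the recursion to the process: cylinder events and Lévy's upward theorem -/

section

variable {Ω : Type*}

/-- The initial piece of length `n + 1` of the path of a process. -/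
def initialPath (X : ℕ → Ω → ℕ × ℕ) (n : ℕ) (ω : Ω) : Fin (n + 1) → ℕ × ℕ := fun i => X i ω

/-- The event that both colours are drawn for ever. -/
def bothColours (X : ℕ → Ω → ℕ × ℕ) : Set Ω :=
  {ω | ∀ N, ∃ n, N ≤ (X n ω).1 ∧ N ≤ (X n ω).2}

lemma exists_setOf_eq_preimage (X : ℕ → Ω → ℕ × ℕ) (n : ℕ) (u : Fin (n + 1) → ℕ × ℕ) :
    ∃ x : ℕ → ℕ × ℕ, x n = u (Fin.last n) ∧
      {ω | ∀ i ≤ n, X i ω = x i} = initialPath X n ⁻¹' {u} := by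
  -- The value 0 beyond time `n` plays no role.
  refine ⟨fun i => if h : i < n + 1 then u ⟨i, h⟩ else 0, by simp [Fin.last], ?_⟩
  ext ω
  simp only [Set.mem_ofPred_eq, Set.mem_preimage, Set.mem_singleton_iff, funext_iff, initialPath]
  constructor
  · intro h i
    have := h i (by omega)
    simpa [i.2] using this
  · intro h i hi
    have := h ⟨i, by omega⟩
    simpa [Nat.lt_succ_of_le hi] using this

/-- A cylinder event extended by one step is again a cylinder event, so the hypothesis `step` can be
iterated. -/
lemma setOf_path_update (X : ℕ → Ω → ℕ × ℕ) (n : ℕ) (x : ℕ → ℕ × ℕ) (v : ℕ × ℕ) :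
    {ω | ∀ i ≤ n + 1, X i ω = Function.update x (n + 1) v i} =
      {ω | (∀ i ≤ n, X i ω = x i) ∧ X (n + 1) ω = v} := by
  ext ω
  simp only [Set.mem_ofPred_eq]
  constructor
  · intro h
    refine ⟨fun i hi => ?_, by simpa using h (n + 1) le_rfl⟩
    have := h i (by omega)
    rwa [Function.update_of_ne (by omega)] at this
  · rintro ⟨h1, h2⟩ i hi
    rcases eq_or_ne i (n + 1) with rfl | hne
    · simpa using h2
    · rw [Function.update_of_ne hne]
      exact h1 i (by omega)

end

section

variable {Ω : Type*} [MeasurableSpace Ω] {μ : Measure Ω} [IsProbabilityMeasure μ]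
  {d : ℕ} {w : ℕ → ℝ} {X : ℕ → Ω → ℕ × ℕ}

lemma measurable_initialPath (hX : ∀ n, Measurable (X n)) (n : ℕ) :
    Measurable (initialPath X n) :=
  measurable_pi_lambda _ fun _ => hX _

lemma measurableSet_setOf_path (hX : ∀ n, Measurable (X n)) (n : ℕ) (x : ℕ → ℕ × ℕ) :
    MeasurableSet {ω | ∀ i ≤ n, X i ω = x i} := by
  have e : {ω | ∀ i ≤ n, X i ω = x i} = ⋂ i ≤ n, X i ⁻¹' {x i} := by ext; simp
  rw [e]
  exact MeasurableSet.iInter fun i => MeasurableSet.iInter fun _ =>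
    hX i (MeasurableSet.singleton _)

/-- Almost every path of the urn process is a path of the urn. -/
lemma IsUrnProcess.ae_isUrnPath (hpos : ∀ i, 0 < w i) (hX : IsUrnProcess d w μ X) :
    ∀ᵐ ω ∂μ, IsUrnPath d (fun n => X n ω) := by
  refine ae_all_iff.2 fun n => ?_
  have key : ∀ u : Fin (n + 1) → ℕ × ℕ, ∀ᵐ ω ∂μ, initialPath X n ω = u →
      ∃ a ≤ d, X (n + 1) ω = X n ω + (a, d - a) := by
    intro u
    obtain ⟨x, -, hx⟩ := exists_setOf_eq_preimage X n u
    set A := {ω | ∀ i ≤ n, X i ω = x i} with hA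
    have hAm : MeasurableSet A := measurableSet_setOf_path hX.measurable n x
    set S : ℕ → Set Ω := fun a => {ω | (∀ i ≤ n, X i ω = x i) ∧ X (n + 1) ω = x n + (a, d - a)}
      with hS
    have hSm : ∀ a, MeasurableSet (S a) := fun a => by
      simp only [hS]
      rw [← setOf_path_update]
      exact measurableSet_setOf_path hX.measurable _ _
    have hdisj : Set.PairwiseDisjoint (↑(range (d + 1))) S := by
      intro a _ b _ hab
      refine Set.disjoint_left.2 fun ω h1 h2 => hab ?_
      have := h1.2.symm.trans h2.2
      simpa using (congrArg Prod.fst this)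
    have hUm : MeasurableSet (⋃ a ∈ range (d + 1), S a) :=
      Finset.measurableSet_biUnion _ fun a _ => hSm a
    -- The admissible steps exhaust the cylinder because their probabilities sum to 1.
    have hU : μ.real (⋃ a ∈ range (d + 1), S a) = μ.real A := by
      rw [measureReal_biUnion_finset hdisj fun a _ => hSm a]
      have : ∀ a ∈ range (d + 1), μ.real (S a) = μ.real A * stepProb d w (x n) a := fun a ha =>
        hX.step n x a (by have := mem_range.1 ha; omega)
      rw [sum_congr rfl this, ← mul_sum, sum_stepProb hpos, mul_one]
    have hsub : (⋃ a ∈ range (d + 1), S a) ⊆ A := Set.iUnion₂_subset fun a _ ω h => h.1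
    have hnull : μ (A \ ⋃ a ∈ range (d + 1), S a) = 0 := by
      rw [← measureReal_eq_zero_iff, measureReal_sdiff hsub hUm, hU, sub_self]
    have hae : ∀ᵐ ω ∂μ, ω ∉ A \ ⋃ a ∈ range (d + 1), S a := measure_eq_zero_iff_ae_notMem.1 hnull
    filter_upwards [hae] with ω hω hu
    have hωA : ω ∈ A := by rw [hx]; exact hu
    have hmem : ω ∈ ⋃ a ∈ range (d + 1), S a := by
      by_contra hcon
      exact hω ⟨hωA, hcon⟩
    simp only [Set.mem_iUnion] at hmem
    obtain ⟨a, ha, h⟩ := hmem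
    exact ⟨a, by have := mem_range.1 ha; omega, by rw [h.2, h.1 n le_rfl]⟩
  filter_upwards [ae_all_iff.2 key] with ω hω using hω _ rfl

/-- The law of the urn process after time `n` is controlled by `urnExp`. -/
lemma IsUrnProcess.measureReal_le (hpos : ∀ i, 0 < w i) (hX : IsUrnProcess d w μ X)
    (B : Set ((ℕ × ℕ) × ℝ)) (k n : ℕ) (x : ℕ → ℕ × ℕ) (z : ℝ) :
    μ.real {ω | (∀ i ≤ n, X i ω = x i) ∧
      (X (n + k) ω, z + ∑ j ∈ range k, gain w (X (n + j) ω) (X (n + (j + 1)) ω)) ∈ B} ≤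
      μ.real {ω | ∀ i ≤ n, X i ω = x i} *
        urnExp d w k (fun y z => B.indicator 1 (y, z)) (x n) z := by
  induction k generalizing n x z with
  | zero =>
    simp only [urnExp, range_zero, sum_empty, add_zero]
    by_cases h : (x n, z) ∈ B
    · rw [Set.indicator_of_mem h, Pi.one_apply, mul_one]
      exact measureReal_mono fun ω hω => hω.1
    · rw [Set.indicator_of_notMem h, mul_zero]
      refine le_of_eq ?_
      rw [measureReal_eq_zero_iff]
      refine measure_mono_null (t := ∅) (fun ω hω => h ?_) measure_empty
      have := hω.2
      rwa [hω.1 n le_rfl] at this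
  | succ k ih =>
    set T : ℕ → Set Ω := fun a =>
      {ω | (∀ i ≤ n + 1, X i ω = Function.update x (n + 1) (x n + (a, d - a)) i) ∧
        (X (n + 1 + k) ω, (z + gain w (x n) (x n + (a, d - a))) +
          ∑ j ∈ range k, gain w (X (n + 1 + j) ω) (X (n + 1 + (j + 1)) ω)) ∈ B} with hT
    have hle : μ.real {ω | (∀ i ≤ n, X i ω = x i) ∧
        (X (n + (k + 1)) ω, z + ∑ j ∈ range (k + 1),
          gain w (X (n + j) ω) (X (n + (j + 1)) ω)) ∈ B} ≤
        μ.real (⋃ a ∈ range (d + 1), T a) := by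
      refine ENNReal.toReal_mono (measure_ne_top _ _) (measure_mono_ae ?_)
      filter_upwards [hX.ae_isUrnPath hpos] with ω hω h
      obtain ⟨h1, h2⟩ := h
      obtain ⟨a, ha, hstep⟩ := hω n
      refine Set.mem_iUnion₂.2 ⟨a, mem_range.2 (by omega), ?_⟩
      have hs : X (n + 1) ω = x n + (a, d - a) := by
        rw [show X (n + 1) ω = X n ω + (a, d - a) from hstep, h1 n le_rfl]
      constructor
      · have : ω ∈ {ω | (∀ i ≤ n, X i ω = x i) ∧ X (n + 1) ω = x n + (a, d - a)} := ⟨h1, hs⟩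
        rw [← setOf_path_update] at this
        exact this
      · rw [sum_range_succ'] at h2
        simp only [add_zero, zero_add, hs, h1 n le_rfl] at h2
        convert h2 using 2
        · congr 1; omega
        · rw [add_assoc, add_comm (gain _ _ _)]
          congr 2
          refine sum_congr rfl fun j _ => ?_
          congr 2 <;> omega
    refine hle.trans ((measureReal_biUnion_finset_le _ _).trans ?_)
    simp only [urnExp, mul_sum]
    refine sum_le_sum fun a ha => (ih (n + 1) _ _).trans_eq ?_
    rw [setOf_path_update, hX.step n x a (by have := mem_range.1 ha; omega), Function.update_self]
    ring

/-- From an escaping state, a tie has conditional probability at most `1 - c`. -/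
lemma IsUrnProcess.measure_inter_bothColours_le (hpos : ∀ i, 0 < w i) (hX : IsUrnProcess d w μ X)
    {c : ℝ} {n : ℕ} {x : ℕ → ℕ × ℕ} (hx : IsEscaping d w c (x n)) :
    μ ({ω | ∀ i ≤ n, X i ω = x i} ∩ bothColours X) ≤
      ENNReal.ofReal (1 - c) * μ {ω | ∀ i ≤ n, X i ω = x i} := by
  obtain ⟨B, hB1, hB2⟩ := hx
  set S : ℕ → Set Ω := fun k => {ω | (∀ i ≤ n, X i ω = x i) ∧
      (X (n + k) ω, 0 + ∑ j ∈ range k, gain w (X (n + j) ω) (X (n + (j + 1)) ω)) ∈ B} with hS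
  have hc : 0 ≤ 1 - c := by
    refine le_trans ?_ (hB1 0)
    exact Set.indicator_nonneg (fun _ _ => zero_le_one) _
  have hSk : ∀ k, μ (S k) ≤ ENNReal.ofReal (1 - c) * μ {ω | ∀ i ≤ n, X i ω = x i} := fun k => by
    rw [← ofReal_measureReal (s := S k),
      ← ofReal_measureReal (s := {ω | ∀ i ≤ n, X i ω = x i}), ← ENNReal.ofReal_mul hc]
    refine ENNReal.ofReal_le_ofReal ((hX.measureReal_le hpos B k n x 0).trans ?_)
    rw [mul_comm]
    exact mul_le_mul_of_nonneg_right (hB1 k) measureReal_nonneg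
  -- A tie lies almost surely in the lower limit of the events `S k`, whose measure is at most the
  -- uniform bound on each `μ (S k)`.
  have hsub : μ ({ω | ∀ i ≤ n, X i ω = x i} ∩ bothColours X) ≤
      μ (⋃ N, ⋂ k, ⋂ (_ : N ≤ k), S k) := by
    refine measure_mono_ae ?_
    filter_upwards [hX.ae_isUrnPath hpos] with ω hω h
    have hinf : ∀ N, ∃ k, N ≤ (X (n + k) ω).1 ∧ N ≤ (X (n + k) ω).2 := fun N => by
      obtain ⟨m, hm⟩ := h.2 N
      have := hω.monotone (Nat.le_add_left m n)
      exact ⟨m, hm.1.trans this.1, hm.2.trans this.2⟩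
    obtain ⟨N, hN⟩ := eventually_atTop.1
      (hB2 (fun k => X (n + k) ω) (h.1 n le_rfl) (hω.shift n) hinf)
    refine Set.mem_iUnion.2 ⟨N, Set.mem_iInter₂.2 fun k hk => ⟨h.1, ?_⟩⟩
    rw [zero_add]
    exact hN k hk
  refine hsub.trans ?_
  rw [Monotone.measure_iUnion fun M N hMN => Set.biInter_subset_biInter_left
    fun k hk => le_trans hMN hk]
  exact iSup_le fun N => (measure_mono (Set.biInter_subset_of_mem le_rfl)).trans (hSk N)

/-- The filtration generated by a process. -/
def pathFiltration (hX : ∀ n, Measurable (X n)) : Filtration ℕ (‹MeasurableSpace Ω›) where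
  seq n := MeasurableSpace.comap (initialPath X n) inferInstance
  mono' m n hmn := by
    have hf : Measurable fun (u : Fin (n + 1) → ℕ × ℕ) (i : Fin (m + 1)) =>
        u (Fin.castLE (Nat.succ_le_succ hmn) i) :=
      measurable_pi_lambda _ fun _ => measurable_pi_apply _
    have e : initialPath X m = (fun (u : Fin (n + 1) → ℕ × ℕ) (i : Fin (m + 1)) =>
        u (Fin.castLE (Nat.succ_le_succ hmn) i)) ∘ initialPath X n := rfl
    simp only [e, ← MeasurableSpace.comap_comp]
    exact MeasurableSpace.comap_mono hf.comap_le
  le' n := (measurable_initialPath hX n).comap_le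

lemma measurableSet_bothColours (hX : ∀ n, Measurable (X n)) :
    MeasurableSet[⨆ n, pathFiltration hX n] (bothColours X) := by
  have e : bothColours X = ⋂ N, ⋃ n, {ω | N ≤ (X n ω).1 ∧ N ≤ (X n ω).2} := by
    ext; simp [bothColours]
  rw [e]
  refine MeasurableSet.iInter fun N => MeasurableSet.iUnion fun n => ?_
  refine le_iSup (fun n => (pathFiltration hX n)) n _ ?_
  exact ⟨{u | N ≤ (u (Fin.last n)).1 ∧ N ≤ (u (Fin.last n)).2},
    (Set.to_countable _).measurableSet, rfl⟩

/-- At escaping states the conditional probability of a tie is at most `1 - c`. -/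
lemma IsUrnProcess.condExp_bothColours_le (hpos : ∀ i, 0 < w i) (hX : IsUrnProcess d w μ X)
    {c : ℝ} (hc : c ≤ 1) (n : ℕ) :
    ∀ᵐ ω ∂μ, IsEscaping d w c (X n ω) →
      (μ[(bothColours X).indicator fun _ => (1 : ℝ) | pathFiltration hX.measurable n]) ω ≤
        1 - c := by
  set ℱ := pathFiltration hX.measurable
  have hE : MeasurableSet (bothColours X) :=
    (iSup_le fun n => ℱ.le n) _ (measurableSet_bothColours hX.measurable)
  set f := μ[(bothColours X).indicator fun _ => (1 : ℝ) | ℱ n] with hf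
  have hfm : Measurable[ℱ n] f := stronglyMeasurable_condExp.measurable
  set s : Set Ω := {ω | 1 - c < f ω} ∩ {ω | IsEscaping d w c (X n ω)} with hs
  have hesc : MeasurableSet[ℱ n] {ω | IsEscaping d w c (X n ω)} :=
    ⟨{u | IsEscaping d w c (u (Fin.last n))}, (Set.to_countable _).measurableSet, rfl⟩
  have hsm : MeasurableSet[ℱ n] s :=
    MeasurableSet.inter (hfm measurableSet_Ioi) hesc
  have hsm' : MeasurableSet s := ℱ.le n _ hsm
  -- There are countably many initial pieces, so `s` splits into cylinders, and each nonempty one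
  -- ends at an escaping state.
  have hle : μ (s ∩ bothColours X) ≤ ENNReal.ofReal (1 - c) * μ s := by
    obtain ⟨V, -, hV⟩ := hsm
    have hVm : ∀ u ∈ V, MeasurableSet (initialPath X n ⁻¹' {u}) := fun u _ =>
      measurable_initialPath hX.measurable n (MeasurableSet.singleton u)
    rw [← Measure.restrict_apply hsm', ← hV,
      ← tsum_measure_preimage_singleton (Set.to_countable V) hVm,
      ← tsum_measure_preimage_singleton (Set.to_countable V) hVm, ← ENNReal.tsum_mul_left]
    refine ENNReal.tsum_le_tsum fun ⟨u, hu⟩ => ?_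
    rw [Measure.restrict_apply (hVm u hu)]
    rcases (initialPath X n ⁻¹' {u}).eq_empty_or_nonempty with h | ⟨ω, hω⟩
    · simp [h]
    · obtain ⟨x, hxn, hx⟩ := exists_setOf_eq_preimage X n u
      have hωs : ω ∈ s := by
        rw [← hV, Set.mem_preimage, show initialPath X n ω = u from hω]
        exact hu
      have hXn : X n ω = x n := by
        rw [hxn, ← show initialPath X n ω = u from hω]
        simp [initialPath]
      rw [← hx]
      exact hX.measure_inter_bothColours_le hpos (hXn ▸ hωs.2)
  have hint : Integrable ((bothColours X).indicator fun _ => (1 : ℝ)) μ :=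
    (integrable_const _).indicator hE
  have h1 : ∫ ω in s, f ω ∂μ = μ.real (s ∩ bothColours X) := by
    rw [hf, setIntegral_condExp (ℱ.le n) hint hsm, setIntegral_indicator hE]
    simp
  have h2 : μ.real (s ∩ bothColours X) ≤ (1 - c) * μ.real s := by
    have := ENNReal.toReal_mono (ENNReal.mul_ne_top ENNReal.ofReal_ne_top (measure_ne_top _ _)) hle
    rwa [ENNReal.toReal_mul, ENNReal.toReal_ofReal (by linarith)] at this
  have hnull : μ s = 0 := by
    by_contra hne
    have hfi : IntegrableOn (fun ω => f ω - (1 - c)) s μ :=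
      (integrable_condExp.sub (integrable_const _)).integrableOn
    have hpos' : 0 < ∫ ω in s, (f ω - (1 - c)) ∂μ := by
      rw [setIntegral_pos_iff_support_of_nonneg_ae
        ((ae_restrict_iff' hsm').2 (Eventually.of_forall fun ω hω => sub_nonneg.2 (le_of_lt hω.1)))
        hfi]
      refine lt_of_lt_of_le (pos_iff_ne_zero.2 hne) (measure_mono fun ω hω => ⟨?_, hω⟩)
      exact (sub_pos.2 hω.1).ne'
    rw [integral_sub integrable_condExp.integrableOn (integrable_const _), h1] at hpos'
    simp only [integral_const, smul_eq_mul, measureReal_restrict_apply_univ] at hpos'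
    linarith
  filter_upwards [measure_eq_zero_iff_ae_notMem.1 hnull] with ω hω hx
  by_contra hcon
  exact hω ⟨not_le.1 hcon, hx⟩

/-- Almost surely, one of the two colours is drawn only finitely often. -/
lemma IsUrnProcess.ae_notMem_bothColours (hd : 1 ≤ d) (hpos : ∀ i, 0 < w i) (hmono : Monotone w)
    (hsum : Summable (fun i => 1 / w i)) (hX : IsUrnProcess d w μ X) :
    ∀ᵐ ω ∂μ, ω ∉ bothColours X := by
  obtain ⟨c, hc, hfreq⟩ := exists_frequently_isEscaping hd hpos hmono hsum
  -- Capping at 1 keeps `1 - c` nonnegative, as the conditional bound requires.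
  have hc' : min c 1 ≤ 1 := min_le_right _ _
  set ℱ := pathFiltration hX.measurable
  have hEm := measurableSet_bothColours hX.measurable
  have hE : MeasurableSet (bothColours X) := (iSup_le fun n => ℱ.le n) _ hEm
  have hint : Integrable ((bothColours X).indicator fun _ => (1 : ℝ)) μ :=
    (integrable_const _).indicator hE
  have hlevy := hint.tendsto_ae_condExp (ℱ := ℱ)
    ((@stronglyMeasurable_const _ _ (⨆ n, ℱ n) _ 1).indicator hEm)
  filter_upwards [hlevy, hX.ae_isUrnPath hpos, hX.start,
    ae_all_iff.2 (hX.condExp_bothColours_le hpos hc')] with ω h1 h2 h3 h4 hω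
  rw [Set.indicator_of_mem hω] at h1
  have h5 : ∀ᶠ n in atTop, 1 - min c 1 <
      (μ[(bothColours X).indicator fun _ => (1 : ℝ) | ℱ n]) ω :=
    h1.eventually_const_lt (by have := lt_min hc one_pos; linarith)
  obtain ⟨n, hn1, hn2⟩ := ((hfreq (fun n => X n ω) h2 h3 hω).and_eventually h5).exists
  exact absurd (h4 n (hn1.mono (min_le_left _ _))) (not_le.2 hn2)

end

end DrawUrn

theorem theorem2p3 {Ω : Type*} [MeasurableSpace Ω] (μ : Measure Ω) [IsProbabilityMeasure μ]
    (d : ℕ) (hd : 2 ≤ d) (w : ℕ → ℝ) (hpos : ∀ i, 0 < w i) (hmono : Monotone w)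
    (hsum : Summable (fun i => 1 / w i))
    (X : ℕ → Ω → ℕ × ℕ) (hX : DrawUrn.IsUrnProcess d w μ X) :
    μ (DrawUrn.eventuallyOneColour d X) = 1 := by
  have hae : DrawUrn.eventuallyOneColour d X =ᵐ[μ] Set.univ := by
    refine Filter.eventuallyEq_univ.2 ?_
    filter_upwards [hX.ae_isUrnPath hpos,
      hX.ae_notMem_bothColours (by omega) hpos hmono hsum] with ω h1 h2
    exact h1.eventually_one_colour h2
  rw [measure_congr hae, measure_univ]
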